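/- Let $\epsilon,\sigma\in\mathbb{R}$ and put $$a=\tfrac{5\sigma}{4}-\tfrac{\epsilon}{4}+\tfrac34,\quad b=\tfrac{\epsilon}{16}-\tfrac{15\sigma}{16}-\tfrac1{16},\quad c=\tfrac{\epsilon}{8}+\tfrac{3\sigma}{8}-\tfrac38,\quad d=\tfrac1{16}-\tfrac{\sigma}{16}-\tfrac{\epsilon}{16},$$ $$a_1=\tfrac{5\sigma}{4}-\tfrac{3\epsilon}{16}+\tfrac{11}{16},\quad a_0=\tfrac{13\sigma}{8}-\tfrac{5\epsilon}{16}+\tfrac{13}{16},\quad b_0=\tfrac5{16}-\tfrac{9\sigma}{8}-\tfrac{\epsilon}{16},\quad c_0=\tfrac{3\epsilon}{16}+\tfrac{7\sigma}{16}-\tfrac7{16}.$$ For $N\ge 4$ and $h>0$ let $T_{\epsilon,\sigma}$ (the stiffness matrix of the one-dimensional cell-centered Galerkin method on a uniform mesh of $N$ cells of width $h$) be the symmetric $N\times N$ matrix equal to $\frac1h$ times the matrix with main diagonal $(a_0,a_1,a,\dots,a,a_1,a_0)$, first super- and subdiagonals $(b_0,b,\dots,b,b_0)$, second super- and subdiagonals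 $(c_0,c,\dots,c,c_0)$, third super- and subdiagonals $(d,\dots,d)$, and all other entries $0$. Let $T_M$ be the symmetric $N\times N$ Toeplitz matrix whose main diagonal entries are $A=\max\{a_0,a_1,a\}$, whose first, second and third super- and subdiagonal entries are $B=\max\{b_0,b\}$, $C=\max\{c_0,c\}$ and $d$ respectively, and whose other entries are $0$. Call a real square matrix monotone if it is nonsingular and its inverse is entrywise nonnegative, and call it an $M$-matrix if it has the form $sI-P$ with $s>0$, $P$ entrywise nonnegative, and $s\ge\rho(P)$, the spectral radius of $P$. If $\sigma+\epsilon=1$ and $1<\sigma\le \frac{104\sqrt2}{79}-\frac{12}{79}$, then $T_M$ and $T_{\epsilon,\sigma}$ are monotone, and $T_{\epsilon,\sigma}$ is not an $M$-matrix. -/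

import Mathlib

namespace CCG

/-- Coefficients of the one-dimensional cell-centred Galerkin stiffness matrix. -/
noncomputable def coeffA (ε σ : ℝ) : ℝ := 5 * σ / 4 - ε / 4 + 3 / 4

noncomputable def coeffB (ε σ : ℝ) : ℝ := ε / 16 - 15 * σ / 16 - 1 / 16

noncomputable def coeffC (ε σ : ℝ) : ℝ := ε / 8 + 3 * σ / 8 - 3 / 8

noncomputable def coeffD (ε σ : ℝ) : ℝ := 1 / 16 - σ / 16 - ε / 16

noncomputable def coeffA1 (ε σ : ℝ) : ℝ := 5 * σ / 4 - 3 * ε / 16 + 11 / 16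

noncomputable def coeffA0 (ε σ : ℝ) : ℝ := 13 * σ / 8 - 5 * ε / 16 + 13 / 16

noncomputable def coeffB0 (ε σ : ℝ) : ℝ := 5 / 16 - 9 * σ / 8 - ε / 16

noncomputable def coeffC0 (ε σ : ℝ) : ℝ := 3 * ε / 16 + 7 * σ / 16 - 7 / 16

/-- `AtDist k i j`: the position `(i, j)` lies on the `k`-th super- or sub-diagonal. -/
def AtDist {N : ℕ} (k : ℕ) (i j : Fin N) : Prop :=
  i.val + k = j.val ∨ j.val + k = i.val

/-- `i` is the first or the last index. -/
def IsEnd {N : ℕ} (i : Fin N) : Prop := i.val = 0 ∨ i.val + 1 = N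

/-- `i` is the second or the second to last index. -/
def IsNextToEnd {N : ℕ} (i : Fin N) : Prop := i.val = 1 ∨ i.val + 2 = N

open Classical in
/-- The `N × N` seven-diagonal CCG stiffness matrix `T_{ε,σ}` on a uniform mesh of width `h`
(meaningful for `N ≥ 4`). Main diagonal `a₀, a₁, a, …, a, a₁, a₀`; first off-diagonals
`b₀, b, …, b, b₀`; second off-diagonals `c₀, c, …, c, c₀`; third off-diagonals `d`;
everything multiplied by `1 / h`. -/
noncomputable def stiffness (N : ℕ) (h ε σ : ℝ) : Matrix (Fin N) (Fin N) ℝ :=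
  (1 / h) • Matrix.of fun i j =>
    if i = j then
      if IsEnd i then coeffA0 ε σ
      else if IsNextToEnd i then coeffA1 ε σ
      else coeffA ε σ
    else if AtDist 1 i j then
      if IsEnd i ∨ IsEnd j then coeffB0 ε σ else coeffB ε σ
    else if AtDist 2 i j then
      if IsEnd i ∨ IsEnd j then coeffC0 ε σ else coeffC ε σ
    else if AtDist 3 i j then coeffD ε σ
    else 0

open Classical in
/-- The symmetric `N × N` Toeplitz comparison matrix `T_M`, with bands
`A = max {a₀, a₁, a}`, `B = max {b₀, b}`, `C = max {c₀, c}` and `d`. -/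
noncomputable def toeplitzMax (N : ℕ) (ε σ : ℝ) : Matrix (Fin N) (Fin N) ℝ :=
  Matrix.of fun i j =>
    if i = j then max (coeffA0 ε σ) (max (coeffA1 ε σ) (coeffA ε σ))
    else if AtDist 1 i j then max (coeffB0 ε σ) (coeffB ε σ)
    else if AtDist 2 i j then max (coeffC0 ε σ) (coeffC ε σ)
    else if AtDist 3 i j then coeffD ε σ
    else 0

/-- A real square matrix is monotone (inverse-nonnegative) if it is nonsingular and its inverse
is entrywise nonnegative. -/
def IsMonotone {N : ℕ} (T : Matrix (Fin N) (Fin N) ℝ) : Prop :=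
  IsUnit T.det ∧ ∀ i j, 0 ≤ T⁻¹ i j

/-- A (possibly singular) `M`-matrix: `T = s I - P` with `s > 0`, `P` entrywise nonnegative and
`s` at least the spectral radius of `P`. -/
def IsMMatrix {N : ℕ} (T : Matrix (Fin N) (Fin N) ℝ) : Prop :=
  ∃ (s : ℝ) (P : Matrix (Fin N) (Fin N) ℝ), 0 < s ∧ (∀ i j, 0 ≤ P i j) ∧
    spectralRadius ℂ (P.map (algebraMap ℝ ℂ)) ≤ ENNReal.ofReal s ∧
    T = s • (1 : Matrix (Fin N) (Fin N) ℝ) - P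

end CCG

/-!
For `σ + ε = 1` the coefficient `d` vanishes and `T_M` is a finite section of a pentadiagonal
Toeplitz matrix with signs `+ - +`. Flipping the sign of the middle bands (a checkerboard
conjugation) makes the symbol a quadratic polynomial in `v = z + z⁻¹ + 2`, and the bound on `σ` is
exactly what makes its roots real and nonpositive. The symbol is then, up to a shift and a positive
factor, a product of factors `1 + ρ z` with `ρ ≥ 0`, each of which preserves total nonnegativity of
a Toeplitz matrix. Hence all minors of the sign-flipped section are nonnegative, and undoing the
conjugation turns this into nonnegativity of the cofactors of `T_M`; nonsingularity is diagonal
dominance.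

Monotonicity passes from `T_M` to the entrywise smaller matrix `h T` because `T` maps a nonnegative
vector to a positive one: the samples of the parabola `x (N - x)`, the solution of the continuous
problem with constant load. The positive entry of `T` in position `(0, 2)` excludes `M`-matrices.
-/

namespace CCG

open scoped LaurentPolynomial
open LaurentPolynomial (C T T_add T_apply T_zero)
open scoped Matrix

section TotalNonnegativity

variable {m n m' n' R : Type*} [CommRing R] [PartialOrder R]

/-- A matrix is totally nonnegative if all its minors are nonnegative. The index types may be
infinite, so that the notion applies to bi-infinite Toeplitz matrices. -/
def IsTotallyNonneg [Preorder m] [Preorder n] (M : Matrix m n R) : Prop :=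
  ∀ (k : ℕ) (r : Fin k → m) (c : Fin k → n), StrictMono r → StrictMono c →
    0 ≤ (M.submatrix r c).det

lemma IsTotallyNonneg.submatrix [Preorder m] [Preorder n] [Preorder m'] [Preorder n']
    {M : Matrix m n R} (hM : IsTotallyNonneg M) {r : m' → m} {c : n' → n} (hr : StrictMono r)
    (hc : StrictMono c) : IsTotallyNonneg (M.submatrix r c) :=
  fun k r' c' hr' hc' => hM k (r ∘ r') (c ∘ c') (hr.comp hr') (hc.comp hc')

/-- Moving some entries of a strictly increasing tuple down by one step leaves it weakly
increasing, so a determinant with the moved rows is a minor of `M` or has two equal rows. -/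
lemma IsTotallyNonneg.det_submatrix_piecewise_pred_nonneg [LinearOrder m] [PredOrder m] [Preorder n]
    {M : Matrix m n R} (hM : IsTotallyNonneg M) {k : ℕ} {r : Fin k → m} {c : Fin k → n}
    (hr : StrictMono r) (hc : StrictMono c) (s : Finset (Fin k)) :
    0 ≤ (M.submatrix (s.piecewise (Order.pred ∘ r) r) c).det := by
  set r' := s.piecewise (Order.pred ∘ r) r with hr'
  have hr'_le (i) : r' i ≤ r i := by
    by_cases hi : i ∈ s <;> simp [hr', hi, Order.pred_le]
  have hpred_le (i) : Order.pred (r i) ≤ r' i := by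
    by_cases hi : i ∈ s <;> simp [hr', hi, Order.pred_le]
  have hmono : Monotone r' := monotone_iff_forall_lt.2 fun i j hij =>
    (hr'_le i).trans ((Order.le_pred_of_lt (hr hij)).trans (hpred_le j))
  by_cases hinj : Function.Injective r'
  · exact hM k r' c (hmono.strictMono_of_injective hinj) hc
  · obtain ⟨i, j, hij, hne⟩ := Function.not_injective_iff.1 hinj
    exact (Matrix.det_zero_of_row_eq hne (by ext l; simp [hij])).ge

variable [IsOrderedRing R]

lemma IsTotallyNonneg.smul [Preorder m] [Preorder n] {M : Matrix m n R} (hM : IsTotallyNonneg M)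
    {a : R} (ha : 0 ≤ a) : IsTotallyNonneg (a • M) := by
  intro k r c hr hc
  rw [Matrix.submatrix_smul, Pi.smul_apply, Pi.smul_apply, Matrix.det_smul]
  exact mul_nonneg (pow_nonneg ha _) (hM k r c hr hc)

lemma isTotallyNonneg_one [LinearOrder m] : IsTotallyNonneg (1 : Matrix m m R) := by
  intro k r c hr hc
  by_cases hrow : ∃ i, ∀ j, r i ≠ c j
  · obtain ⟨i, hi⟩ := hrow
    exact (Matrix.det_eq_zero_of_row_eq_zero i fun j => by
      rw [Matrix.submatrix_apply, Matrix.one_apply_ne (hi j)]).ge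
  · push Not at hrow
    choose φ hφ using hrow
    have hφ_inj : Function.Injective φ := fun i j hij => hr.injective (by rw [hφ, hφ, hij])
    have hrange : Set.range r = Set.range c := by
      rw [funext hφ]
      exact (Finite.surjective_of_injective hφ_inj).range_comp c
    rw [(hr.range_inj hc).1 hrange, Matrix.submatrix_one _ hc.injective, Matrix.det_one]
    exact zero_le_one

lemma IsTotallyNonneg.add_smul_pred [LinearOrder m] [PredOrder m] [Preorder n] {M : Matrix m n R}
    (hM : IsTotallyNonneg M) {ρ : R} (hρ : 0 ≤ ρ) :
    IsTotallyNonneg (M + ρ • M.submatrix Order.pred id) := by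
  intro k r c hr hc
  let rowDet := (Matrix.detRowAlternating (n := Fin k) (R := R)).toMultilinearMap
  let shifted : Fin k → Fin k → R := M.submatrix (Order.pred ∘ r) c
  let rows : Fin k → Fin k → R := M.submatrix r c
  have hdet : ((M + ρ • M.submatrix Order.pred id).submatrix r c).det =
      ∑ s : Finset (Fin k), rowDet (s.piecewise (fun i => ρ • shifted i) rows) := by
    rw [← MultilinearMap.map_add_univ, add_comm]
    rfl
  rw [hdet]
  refine Finset.sum_nonneg fun s _ => ?_
  have hsmul : s.piecewise (fun i => ρ • shifted i) rows =
      s.piecewise (fun i => ρ • s.piecewise shifted rows i) (s.piecewise shifted rows) := by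
    ext i j
    by_cases hi : i ∈ s <;> simp [hi]
  have hminor : rowDet (s.piecewise shifted rows) =
      (M.submatrix (s.piecewise (Order.pred ∘ r) r) c).det := by
    change Matrix.det _ = Matrix.det _
    congr 1
    ext i j
    by_cases hi : i ∈ s <;>
      simp only [Finset.piecewise, hi, Matrix.submatrix_apply, shifted, rows, if_true, if_false]
  rw [hsmul, MultilinearMap.map_piecewise_smul rowDet (fun _ => ρ), hminor]
  exact smul_nonneg (Finset.prod_nonneg fun _ _ => hρ)
    (hM.det_submatrix_piecewise_pred_nonneg hr hc s)

end TotalNonnegativity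

section Toeplitz

variable {R : Type*} [CommRing R]

/-- The bi-infinite Toeplitz matrix whose symbol is the Laurent polynomial `f`. -/
def toeplitz (f : R[T;T⁻¹]) : Matrix ℤ ℤ R := Matrix.of fun i j => f.coeff (i - j)

lemma toeplitz_apply (f : R[T;T⁻¹]) (i j : ℤ) : toeplitz f i j = f.coeff (i - j) := rfl

lemma toeplitz_one : toeplitz (1 : R[T;T⁻¹]) = 1 := by
  ext i j
  rw [toeplitz_apply, ← T_zero, T_apply, Matrix.one_apply]
  simp only [eq_comm (a := (0 : ℤ)), sub_eq_zero]

lemma toeplitz_add (f g : R[T;T⁻¹]) : toeplitz (f + g) = toeplitz f + toeplitz g := by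
  ext i j
  simp [toeplitz_apply]

lemma toeplitz_C_mul (a : R) (f : R[T;T⁻¹]) : toeplitz (C a * f) = a • toeplitz f := by
  ext i j
  rw [toeplitz_apply, ← LaurentPolynomial.single_eq_C, AddMonoidAlgebra.coeff_single_mul_apply]
  simp [toeplitz_apply]

lemma toeplitz_T_mul (k : ℤ) (f : R[T;T⁻¹]) :
    toeplitz (T k * f) = (toeplitz f).submatrix (fun i => i - k) id := by
  ext i j
  rw [toeplitz_apply, T, AddMonoidAlgebra.coeff_single_mul_apply, one_mul]
  simp only [Matrix.submatrix_apply, toeplitz_apply, id]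
  congr 1
  ring

variable [PartialOrder R] [IsOrderedRing R]

lemma IsTotallyNonneg.toeplitz_one_add_C_mul_T_mul {f : R[T;T⁻¹]}
    (hf : IsTotallyNonneg (toeplitz f)) {ρ : R} (hρ : 0 ≤ ρ) :
    IsTotallyNonneg (toeplitz ((1 + C ρ * T 1) * f)) := by
  have h : toeplitz ((1 + C ρ * T 1) * f) =
      toeplitz f + ρ • (toeplitz f).submatrix Order.pred id := by
    rw [add_mul, one_mul, mul_assoc, toeplitz_add, toeplitz_C_mul, toeplitz_T_mul]
    rfl
  rw [h]
  exact hf.add_smul_pred hρ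

end Toeplitz

section PentadiagonalToeplitz

lemma exists_nonneg_add_eq_mul_eq {s p : ℝ} (hs : 0 ≤ s) (hp : 0 ≤ p) (h : 4 * p ≤ s ^ 2) :
    ∃ x y : ℝ, 0 ≤ x ∧ 0 ≤ y ∧ x + y = s ∧ x * y = p := by
  set d := Real.sqrt (s ^ 2 - 4 * p)
  have hd_sq : d ^ 2 = s ^ 2 - 4 * p := Real.sq_sqrt (by linarith)
  have hd_nonneg : 0 ≤ d := Real.sqrt_nonneg _
  have hd_le : d ≤ s := abs_le_of_sq_le_sq' (by linarith) hs |>.2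
  refine ⟨(s + d) / 2, (s - d) / 2, by linarith, by linarith, by ring, ?_⟩
  linear_combination -hd_sq / 4

/-- For `2 ≤ w` the polynomial `1 + w z + z²` has two negative real roots. -/
lemma IsTotallyNonneg.toeplitz_quadratic_mul {f : ℝ[T;T⁻¹]} (hf : IsTotallyNonneg (toeplitz f))
    {w : ℝ} (hw : 2 ≤ w) : IsTotallyNonneg (toeplitz ((1 + C w * T 1 + T 2) * f)) := by
  obtain ⟨ρ, τ, hρ, hτ, hadd, hmul⟩ :=
    exists_nonneg_add_eq_mul_eq (s := w) (p := 1) (by linarith) zero_le_one (by nlinarith)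
  have hfactor : (1 + C w * T 1 + T 2 : ℝ[T;T⁻¹]) = (1 + C ρ * T 1) * (1 + C τ * T 1) := by
    have hT : (T 2 : ℝ[T;T⁻¹]) = T 1 * T 1 := T_add 1 1
    have hC : (C ρ * C τ : ℝ[T;T⁻¹]) = 1 := by rw [← map_mul, hmul, map_one]
    rw [← hadd, map_add]
    linear_combination hT - T 1 * T 1 * hC
  rw [hfactor, mul_assoc]
  exact (hf.toeplitz_one_add_C_mul_T_mul hτ).toeplitz_one_add_C_mul_T_mul hρ

/-- The symbol of the symmetric pentadiagonal Toeplitz matrix with bands `a`, `b`, `c`. -/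
noncomputable def pentadiagonalSymbol {R : Type*} [Semiring R] (a b c : R) : R[T;T⁻¹] :=
  C a + C b * (T 1 + T (-1)) + C c * (T 2 + T (-2))

lemma coeff_pentadiagonalSymbol {R : Type*} [Semiring R] (a b c : R) (k : ℤ) :
    (pentadiagonalSymbol a b c).coeff k =
      if k = 0 then a else if k.natAbs = 1 then b else if k.natAbs = 2 then c else 0 := by
  simp only [pentadiagonalSymbol, mul_add, ← LaurentPolynomial.single_eq_C,
    AddMonoidAlgebra.coeff_add, AddMonoidAlgebra.coeff_single,
    AddMonoidAlgebra.coeff_single_mul_apply, Finsupp.add_apply, Finsupp.single_apply, T_apply]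
  split_ifs <;> first | omega | simp

/-- Substituting `v = z + z⁻¹ + 2`, the symbol becomes a quadratic polynomial in `v`; the
hypotheses say that it has real roots `-v₁`, `-v₂` with `v₁, v₂ ≥ 0`. -/
lemma isTotallyNonneg_toeplitz_pentadiagonalSymbol {a b c : ℝ} (hc : 0 < c) (hbc : 4 * c ≤ b)
    (hab : 2 * b ≤ a + 2 * c) (hdisc : 4 * c * (a - 2 * c) ≤ b ^ 2) :
    IsTotallyNonneg (toeplitz (pentadiagonalSymbol a b c)) := by
  obtain ⟨v₁, v₂, hv₁, hv₂, hadd, hmul⟩ :=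
    exists_nonneg_add_eq_mul_eq (s := (b - 4 * c) / c) (p := (a + 2 * c - 2 * b) / c)
      (div_nonneg (by linarith) hc.le) (div_nonneg (by linarith) hc.le) (by
        rw [div_pow, mul_div_assoc', div_le_div_iff₀ hc (by positivity)]
        nlinarith)
  have hb : b = c * ((2 + v₁) + (2 + v₂)) := by
    field_simp at hadd
    linear_combination -hadd
  have ha : a = c * (2 + (2 + v₁) * (2 + v₂)) := by
    field_simp at hmul
    linear_combination -hmul + 2 * hb
  have hfactor : pentadiagonalSymbol a b c = C c * (T (-2) *
      ((1 + C (2 + v₁) * T 1 + T 2) * ((1 + C (2 + v₂) * T 1 + T 2) * 1))) := by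
    have hT : (T 2 : ℝ[T;T⁻¹]) = T 1 ^ 2 := by simp
    have hT' : (T (-2) : ℝ[T;T⁻¹]) = T (-1) ^ 2 := by simp
    have hinv : (T 1 * T (-1) : ℝ[T;T⁻¹]) = 1 := by rw [← T_add, add_neg_cancel, T_zero]
    rw [pentadiagonalSymbol, ha, hb, hT, hT']
    simp only [map_mul, map_add, map_ofNat]
    set t : ℝ[T;T⁻¹] := T 1
    set u : ℝ[T;T⁻¹] := T (-1)
    linear_combination -C c * (((2 + C v₁) + (2 + C v₂)) * (u + t * (t * u + 1)) +
      (2 + (2 + C v₁) * (2 + C v₂)) * (t * u + 1) + t ^ 2 * (t * u + 1)) * hinv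
  rw [hfactor, toeplitz_C_mul, toeplitz_T_mul]
  have hone : IsTotallyNonneg (toeplitz (1 : ℝ[T;T⁻¹])) :=
    toeplitz_one (R := ℝ) ▸ isTotallyNonneg_one
  have hquad := (hone.toeplitz_quadratic_mul (w := 2 + v₂) (by linarith)).toeplitz_quadratic_mul
    (w := 2 + v₁) (by linarith)
  exact (hquad.submatrix (fun i j hij => by simpa using hij) strictMono_id).smul hc.le

end PentadiagonalToeplitz

section Monotone

variable {N : ℕ}

lemma isMonotone_iff_nonneg_of_mulVec_nonneg {M : Matrix (Fin N) (Fin N) ℝ} :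
    IsMonotone M ↔ ∀ u, 0 ≤ M *ᵥ u → 0 ≤ u := by
  refine ⟨fun hM u hu => ?_, fun hM => ?_⟩
  · rw [← Matrix.one_mulVec u, ← Matrix.nonsing_inv_mul _ hM.1, ← Matrix.mulVec_mulVec]
    intro i
    change 0 ≤ ∑ j, M⁻¹ i j * (M *ᵥ u) j
    exact Finset.sum_nonneg fun j _ => mul_nonneg (hM.2 i j) (hu j)
  · have hinj : Function.Injective M.mulVec := fun u v huv => by
      have h₁ := hM (u - v) (by rw [Matrix.mulVec_sub, huv, sub_self])
      have h₂ := hM (v - u) (by rw [Matrix.mulVec_sub, huv, sub_self])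
      exact le_antisymm (sub_nonneg.1 h₂) (sub_nonneg.1 h₁)
    have hunit : IsUnit M.det :=
      (Matrix.isUnit_iff_isUnit_det M).1 (Matrix.mulVec_injective_iff_isUnit.1 hinj)
    refine ⟨hunit, fun i j => hM (M⁻¹ *ᵥ Pi.single j 1) ?_ i |>.trans_eq (by simp)⟩
    rw [Matrix.mulVec_mulVec, Matrix.mul_nonsing_inv _ hunit, Matrix.one_mulVec]
    exact Pi.single_nonneg.2 zero_le_one

lemma IsMonotone.smul {M : Matrix (Fin N) (Fin N) ℝ} (hM : IsMonotone M) {a : ℝ} (ha : 0 < a) :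
    IsMonotone (a • M) := by
  rw [isMonotone_iff_nonneg_of_mulVec_nonneg] at hM ⊢
  intro u hu
  refine hM u ?_
  rwa [Matrix.smul_mulVec, smul_nonneg_iff_nonneg_of_pos_left ha] at hu

lemma IsMonotone.pos_of_mulVec_pos {M : Matrix (Fin N) (Fin N) ℝ} (hM : IsMonotone M)
    {u : Fin N → ℝ} (hu : ∀ i, 0 < (M *ᵥ u) i) (i : Fin N) : 0 < u i := by
  obtain ⟨j, hj⟩ : ∃ j, M⁻¹ i j ≠ 0 := by
    by_contra! hrow
    have hone : (M⁻¹ * M) i i = 1 := by rw [Matrix.nonsing_inv_mul _ hM.1, Matrix.one_apply_eq]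
    simp [Matrix.mul_apply, hrow] at hone
  rw [← Matrix.one_mulVec u, ← Matrix.nonsing_inv_mul _ hM.1, ← Matrix.mulVec_mulVec]
  exact Finset.sum_pos' (fun k _ => mul_nonneg (hM.2 i k) (hu k).le)
    ⟨j, Finset.mem_univ j, mul_pos ((hM.2 i j).lt_of_ne' hj) (hu j)⟩

lemma exists_pos_add_smul_nonneg_apply_eq_zero {ι : Type*} [Finite ι] {u e : ι → ℝ}
    (he : ∀ i, 0 < e i) {i₀ : ι} (hi₀ : u i₀ < 0) :
    ∃ t : ℝ, 0 < t ∧ 0 ≤ u + t • e ∧ ∃ k, (u + t • e) k = 0 := by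
  have := Nonempty.intro i₀
  obtain ⟨k, hk⟩ := Finite.exists_min fun i => u i / e i
  refine ⟨-(u k / e k), ?_, fun i => ?_, k, ?_⟩
  · exact neg_pos.2 ((hk i₀).trans_lt (div_neg_of_neg_of_pos hi₀ (he i₀)))
  · have := (le_div_iff₀ (he i)).1 (hk i)
    simp only [Pi.zero_apply, Pi.add_apply, Pi.smul_apply, smul_eq_mul]
    linarith
  · simp [(he k).ne']

/-- If `K u ≥ 0` and `u` had a negative entry, the smallest `t` with `v = u + t e ≥ 0` would give a
vector with a vanishing entry, although `M v ≥ K v > 0` forces all entries of `v` to be positive. -/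
lemma IsMonotone.of_le {M K : Matrix (Fin N) (Fin N) ℝ} (hM : IsMonotone M)
    (hle : ∀ i j, K i j ≤ M i j) {e : Fin N → ℝ} (he : 0 ≤ e) (hKe : ∀ i, 0 < (K *ᵥ e) i) :
    IsMonotone K := by
  have hmul_le {v : Fin N → ℝ} (hv : 0 ≤ v) (i : Fin N) : (K *ᵥ v) i ≤ (M *ᵥ v) i := by
    simp only [Matrix.mulVec, dotProduct]
    exact Finset.sum_le_sum fun j _ => mul_le_mul_of_nonneg_right (hle i j) (hv j)
  have he_pos := hM.pos_of_mulVec_pos fun i => (hKe i).trans_le (hmul_le he i)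
  refine isMonotone_iff_nonneg_of_mulVec_nonneg.2 fun u hu => ?_
  by_contra hneg
  obtain ⟨i₀, hi₀⟩ : ∃ i, u i < 0 := by simpa [Pi.le_def] using hneg
  obtain ⟨t, ht, hv, k, hvk⟩ := exists_pos_add_smul_nonneg_apply_eq_zero he_pos hi₀
  have hKv (i) : 0 < (K *ᵥ (u + t • e)) i := by
    rw [Matrix.mulVec_add, Matrix.mulVec_smul]
    exact add_pos_of_nonneg_of_pos (hu i) (mul_pos ht (hKe i))
  exact (hM.pos_of_mulVec_pos (fun i => (hKv i).trans_le (hmul_le hv i)) k).ne' hvk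

lemma IsTotallyNonneg.neg_one_pow_mul_adjugate_nonneg {R : Type*} [CommRing R] [PartialOrder R]
    {Q : Matrix (Fin N) (Fin N) R} (hQ : IsTotallyNonneg Q) (i j : Fin N) :
    0 ≤ (-1) ^ (i + j : ℕ) * Q.adjugate i j := by
  obtain _ | n := N
  · exact i.elim0
  rw [Matrix.adjugate_fin_succ_eq_det_submatrix, ← mul_assoc, add_comm (j : ℕ), ← mul_pow,
    neg_one_mul, neg_neg, one_pow, one_mul]
  exact hQ n _ _ (Fin.strictMono_succAbove j) (Fin.strictMono_succAbove i)

lemma IsTotallyNonneg.isMonotone_checkerboard {Q : Matrix (Fin N) (Fin N) ℝ}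
    (hQ : IsTotallyNonneg Q) (hdet : Q.det ≠ 0) :
    IsMonotone (Matrix.of fun i j : Fin N => (-1) ^ (i + j : ℕ) * Q i j) := by
  let D : Matrix (Fin N) (Fin N) ℝ := Matrix.diagonal fun i => (-1) ^ (i : ℕ)
  have hD : D * D = 1 := by simp [D, Matrix.diagonal_mul_diagonal, ← mul_pow]
  have hD_conj (A : Matrix (Fin N) (Fin N) ℝ) :
      D * A * D = Matrix.of fun i j : Fin N => (-1) ^ (i + j : ℕ) * A i j := by
    ext i j
    rw [Matrix.mul_diagonal, Matrix.diagonal_mul, Matrix.of_apply, pow_add]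
    ring
  have hQ_unit : IsUnit Q.det := hdet.isUnit
  have hinv : (D * Q * D) * (D * Q⁻¹ * D) = 1 := by
    calc D * Q * D * (D * Q⁻¹ * D) = D * (Q * (D * D) * Q⁻¹) * D := by simp only [mul_assoc]
      _ = 1 := by rw [hD, mul_one, Matrix.mul_nonsing_inv _ hQ_unit, mul_one, hD]
  rw [← hD_conj]
  refine ⟨Matrix.isUnit_det_of_right_inverse hinv, fun i j => ?_⟩
  have hQ_det : 0 ≤ Q.det := hQ N id id strictMono_id strictMono_id
  rw [Matrix.inv_eq_right_inv hinv, hD_conj, Matrix.of_apply, Matrix.inv_def,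
    Ring.inverse_eq_inv', Matrix.smul_apply, smul_eq_mul, mul_left_comm]
  exact mul_nonneg (inv_nonneg.2 hQ_det) (hQ.neg_one_pow_mul_adjugate_nonneg i j)

lemma IsMMatrix.apply_nonpos {M : Matrix (Fin N) (Fin N) ℝ} (hM : IsMMatrix M) {i j : Fin N}
    (hij : i ≠ j) : M i j ≤ 0 := by
  obtain ⟨s, P, -, hP, -, rfl⟩ := hM
  simpa [hij] using hP i j

end Monotone

section ToeplitzSection

/-- The leading `N × N` finite section of the Toeplitz matrix with symbol `f`. -/
def toeplitzSection {R : Type*} [CommRing R] (N : ℕ) (f : R[T;T⁻¹]) : Matrix (Fin N) (Fin N) R :=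
  (toeplitz f).submatrix (fun i => (i : ℤ)) fun j => (j : ℤ)

lemma toeplitzSection_apply {R : Type*} [CommRing R] {N : ℕ} (f : R[T;T⁻¹]) (i j : Fin N) :
    toeplitzSection N f i j = f.coeff (i - j) := rfl

lemma IsTotallyNonneg.toeplitzSection {R : Type*} [CommRing R] [PartialOrder R] {f : R[T;T⁻¹]}
    (hf : IsTotallyNonneg (toeplitz f)) (N : ℕ) : IsTotallyNonneg (toeplitzSection N f) :=
  have hcast : StrictMono fun i : Fin N => (i : ℤ) := fun i j hij => by simpa using hij
  hf.submatrix hcast hcast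

lemma det_toeplitzSection_ne_zero_of_sum_lt {K : Type*} [NormedField K] (N : ℕ) {f : K[T;T⁻¹]}
    {s : Finset ℤ} (hs : ∀ k ∉ s, k ≠ 0 → f.coeff k = 0)
    (hf : ∑ k ∈ s, ‖f.coeff k‖ < ‖f.coeff 0‖) : (toeplitzSection N f).det ≠ 0 := by
  refine det_ne_zero_of_sum_row_lt_diag fun i => ?_
  let diff : Fin N → ℤ := fun j => i - j
  have hdiff : Function.Injective diff := fun j k hjk => by simpa [diff, Fin.ext_iff] using hjk
  set t := (Finset.univ.erase i).image diff
  have ht : ∀ k ∈ t, k ≠ 0 := by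
    simp only [t, Finset.forall_mem_image, Finset.mem_erase, diff]
    intro j hj h0
    exact hj.1 (Fin.ext (by omega))
  calc ∑ j ∈ Finset.univ.erase i, ‖toeplitzSection N f i j‖
      = ∑ k ∈ t, ‖f.coeff k‖ := by
        rw [Finset.sum_image hdiff.injOn]
        rfl
    _ ≤ ∑ k ∈ t ∪ s, ‖f.coeff k‖ :=
        Finset.sum_le_sum_of_subset_of_nonneg Finset.subset_union_left fun _ _ _ => norm_nonneg _
    _ = ∑ k ∈ s, ‖f.coeff k‖ := by
        refine (Finset.sum_subset Finset.subset_union_right fun k hk hks => ?_).symm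
        rw [hs k hks (ht k ((Finset.mem_union.1 hk).resolve_right hks)), norm_zero]
    _ < ‖toeplitzSection N f i i‖ := by rwa [toeplitzSection_apply, sub_self]

lemma det_toeplitzSection_pentadiagonalSymbol_ne_zero {K : Type*} [NormedField K] (N : ℕ)
    {a b c : K} (h : 2 * ‖b‖ + 2 * ‖c‖ < ‖a‖) :
    (toeplitzSection N (pentadiagonalSymbol a b c)).det ≠ 0 := by
  refine det_toeplitzSection_ne_zero_of_sum_lt N (s := {-2, -1, 1, 2}) (fun k hk hk0 => ?_) ?_
  · simp only [Finset.mem_insert, Finset.mem_singleton, not_or] at hk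
    rw [coeff_pentadiagonalSymbol, if_neg hk0, if_neg (by omega), if_neg (by omega)]
  · have hsum : ∑ k ∈ {-2, -1, 1, 2}, ‖(pentadiagonalSymbol a b c).coeff k‖ =
        ‖c‖ + (‖b‖ + (‖b‖ + ‖c‖)) := by
      simp [coeff_pentadiagonalSymbol]
    rw [hsum, coeff_pentadiagonalSymbol, if_pos rfl]
    linarith

lemma toeplitzSection_pentadiagonalSymbol_neg {R : Type*} [CommRing R] (N : ℕ) (a b c : R) :
    toeplitzSection N (pentadiagonalSymbol a (-b) c) = Matrix.of fun i j : Fin N =>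
      (-1) ^ (i + j : ℕ) * toeplitzSection N (pentadiagonalSymbol a b c) i j := by
  ext i j
  simp only [Matrix.of_apply, toeplitzSection_apply, coeff_pentadiagonalSymbol]
  split_ifs with h0 h1 h2
  · rw [Even.neg_one_pow (by rw [Nat.even_iff]; omega), one_mul]
  · rw [Odd.neg_one_pow (by rw [Nat.odd_iff]; omega), neg_one_mul]
  · rw [Even.neg_one_pow (by rw [Nat.even_iff]; omega), one_mul]
  · rw [mul_zero]

lemma isMonotone_toeplitzSection_pentadiagonalSymbol_neg (N : ℕ) {a b c : ℝ} (hc : 0 < c)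
    (hbc : 4 * c ≤ b) (hdom : 2 * b + 2 * c < a) (hdisc : 4 * c * (a - 2 * c) ≤ b ^ 2) :
    IsMonotone (toeplitzSection N (pentadiagonalSymbol a (-b) c)) := by
  rw [toeplitzSection_pentadiagonalSymbol_neg]
  have hdet := det_toeplitzSection_pentadiagonalSymbol_ne_zero N (a := a) (b := b) (c := c)
    (by
      rwa [Real.norm_of_nonneg (by linarith), Real.norm_of_nonneg hc.le,
        Real.norm_of_nonneg (by linarith)])
  exact ((isTotallyNonneg_toeplitz_pentadiagonalSymbol hc hbc (by linarith)
    hdisc).toeplitzSection N).isMonotone_checkerboard hdet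

end ToeplitzSection

section Stiffness

variable {N : ℕ}

lemma stiffness_eq_smul (h ε σ : ℝ) : stiffness N h ε σ = (1 / h) • stiffness N 1 ε σ := by
  simp [stiffness]

lemma stiffness_apply_le_toeplitzMax_apply (ε σ : ℝ) (i j : Fin N) :
    stiffness N 1 ε σ i j ≤ toeplitzMax N ε σ i j := by
  simp only [stiffness, toeplitzMax, Matrix.smul_apply, Matrix.of_apply, div_one, one_smul]
  split_ifs <;> simp

lemma toeplitzMax_eq_toeplitzSection {ε σ : ℝ} (hd : coeffD ε σ = 0) :
    toeplitzMax N ε σ = toeplitzSection N (pentadiagonalSymbol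
      (max (coeffA0 ε σ) (max (coeffA1 ε σ) (coeffA ε σ)))
      (max (coeffB0 ε σ) (coeffB ε σ)) (max (coeffC0 ε σ) (coeffC ε σ))) := by
  ext i j
  simp only [toeplitzMax, Matrix.of_apply, toeplitzSection_apply, coeff_pentadiagonalSymbol, hd,
    ite_self, Fin.ext_iff, AtDist]
  exact if_congr (by omega) rfl (if_congr (by omega) rfl (if_congr (by omega) rfl rfl))

lemma toeplitzMax_one_sub {σ : ℝ} (hσ₀ : 0 ≤ σ) (hσ₄ : σ ≤ 4) :
    toeplitzMax N (1 - σ) σ = toeplitzSection N (pentadiagonalSymbol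
      (31 * σ / 16 + 1 / 2) (-(17 * σ / 16 - 1 / 4)) ((σ - 1) / 4)) := by
  rw [toeplitzMax_eq_toeplitzSection (by rw [coeffD]; ring)]
  congr 2
  · rw [max_eq_left (max_le _ _)] <;> simp only [coeffA0, coeffA1, coeffA] <;> linarith
  · rw [max_eq_left] <;> simp only [coeffB0, coeffB] <;> linarith
  · rw [max_eq_left] <;> simp only [coeffC0, coeffC] <;> linarith

/-- The discriminant condition reads `79 σ² + 24 σ ≤ 272`, whose larger root is the bound on `σ`. -/
lemma isMonotone_toeplitzMax_one_sub {σ : ℝ} (hσ₁ : 1 < σ)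
    (hσ : σ ≤ 104 * Real.sqrt 2 / 79 - 12 / 79) :
    IsMonotone (toeplitzMax N (1 - σ) σ) := by
  have hsqrt : Real.sqrt 2 ^ 2 = 2 := Real.sq_sqrt zero_le_two
  have hquad : 79 * σ ^ 2 + 24 * σ ≤ 272 := by
    have hsq : (79 * σ + 12) ^ 2 ≤ (104 * Real.sqrt 2) ^ 2 := by gcongr; linarith
    nlinarith
  have hσ₂ : σ < 2 := by nlinarith
  rw [toeplitzMax_one_sub (by linarith) (by linarith)]
  exact isMonotone_toeplitzSection_pentadiagonalSymbol_neg N (by linarith) (by linarith)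
    (by linarith) (by linarith)

lemma stiffness_one_sub_apply (σ : ℝ) (i j : Fin N) [Decidable (IsEnd i)] [Decidable (IsEnd j)]
    [Decidable (IsNextToEnd i)] [Decidable (AtDist 1 i j)] [Decidable (AtDist 2 i j)] :
    stiffness N 1 (1 - σ) σ i j =
      if i = j then
        if IsEnd i then 31 * σ / 16 + 1 / 2
        else if IsNextToEnd i then 23 * σ / 16 + 1 / 2
        else 3 * σ / 2 + 1 / 2
      else if AtDist 1 i j then
        if IsEnd i ∨ IsEnd j then 1 / 4 - 17 * σ / 16 else -σ
      else if AtDist 2 i j then (σ - 1) / 4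
      else 0 := by
  simp only [stiffness, Matrix.smul_apply, Matrix.of_apply, div_one, one_smul, coeffA, coeffA0,
    coeffA1, coeffB, coeffB0, coeffC, coeffC0, coeffD]
  split_ifs <;> ring

lemma atDist_rev {k : ℕ} {i j : Fin N} : AtDist k i.rev j.rev ↔ AtDist k i j := by
  simp only [AtDist, Fin.val_rev]
  omega

lemma isEnd_rev {i : Fin N} : IsEnd i.rev ↔ IsEnd i := by
  simp only [IsEnd, Fin.val_rev]
  omega

lemma isNextToEnd_rev {i : Fin N} : IsNextToEnd i.rev ↔ IsNextToEnd i := by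
  simp only [IsNextToEnd, Fin.val_rev]
  omega

lemma stiffness_submatrix_rev (h ε σ : ℝ) :
    (stiffness N h ε σ).submatrix Fin.revPerm Fin.revPerm = stiffness N h ε σ := by
  classical
  ext i j
  simp only [stiffness, Matrix.submatrix_apply, Matrix.smul_apply, Matrix.of_apply,
    Fin.revPerm_apply, Fin.rev_inj, atDist_rev, isEnd_rev, isNextToEnd_rev]

/-- Samples of the parabola `x ↦ x (N - x)`, which solves `-u'' = 2` with Dirichlet boundary
conditions, at the cell centres `i + 1/2`. -/
noncomputable def cellParabola (N : ℕ) (i : Fin N) : ℝ := (i + 1 / 2) * (N - (i + 1 / 2))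

lemma cellParabola_nonneg (i : Fin N) : 0 ≤ cellParabola N i := by
  have hi : (i + 1 : ℝ) ≤ N := mod_cast i.isLt
  exact mul_nonneg (by positivity) (by linarith)

lemma cellParabola_rev (i : Fin N) : cellParabola N i.rev = cellParabola N i := by
  have hi : ((i.rev : ℕ) : ℝ) = N - (i + 1) := by
    rw [Fin.val_rev, Nat.cast_sub i.isLt, Nat.cast_succ]
  rw [cellParabola, cellParabola, hi]
  ring

lemma stiffness_mulVec_cellParabola_rev (h ε σ : ℝ) (i : Fin N) :
    (stiffness N h ε σ *ᵥ cellParabola N) i.rev = (stiffness N h ε σ *ᵥ cellParabola N) i := by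
  conv_rhs => rw [← stiffness_submatrix_rev]
  rw [Matrix.submatrix_mulVec_equiv]
  have : cellParabola N ∘ Fin.revPerm.symm = cellParabola N := funext cellParabola_rev
  rw [this]
  rfl

lemma mulVec_apply_eq_sum_window {R : Type*} [NonUnitalNonAssocSemiring R]
    {M : Matrix (Fin N) (Fin N) R} {i : Fin N} {k m : ℕ} (hkm : k + m ≤ N)
    (hM : ∀ j : Fin N, j < k ∨ k + m ≤ j → M i j = 0) (u : Fin N → R) :
    (M *ᵥ u) i = ∑ t : Fin m, M i ⟨k + t, by omega⟩ * u ⟨k + t, by omega⟩ := by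
  refine (Fintype.sum_of_injective (fun t : Fin m => (⟨k + t, by omega⟩ : Fin N))
    (fun s t hst => by simpa [Fin.ext_iff] using hst) _ _ (fun j hj => ?_) fun _ => rfl).symm
  have hj' : (j : ℕ) < k ∨ k + m ≤ j := by
    by_contra! hj'
    exact hj ⟨⟨j - k, by omega⟩, Fin.ext (by simp only; omega)⟩
  exact mul_eq_zero_of_left (hM j hj') _

lemma stiffness_one_sub_apply_eq_zero (σ : ℝ) {i j : Fin N}
    (hij : (i : ℕ) + 2 < j ∨ (j : ℕ) + 2 < i) :
    stiffness N 1 (1 - σ) σ i j = 0 := by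
  classical
  rw [stiffness_one_sub_apply, if_neg, if_neg, if_neg] <;>
    simp only [AtDist, Fin.ext_iff] <;> omega

lemma stiffness_one_sub_mulVec_zero (hN : 4 ≤ N) (σ : ℝ) (u : Fin N → ℝ) :
    (stiffness N 1 (1 - σ) σ *ᵥ u) ⟨0, by omega⟩ =
      (31 * σ / 16 + 1 / 2) * u ⟨0, by omega⟩ + (1 / 4 - 17 * σ / 16) * u ⟨1, by omega⟩ +
        (σ - 1) / 4 * u ⟨2, by omega⟩ := by
  classical
  rw [mulVec_apply_eq_sum_window (k := 0) (m := 3) (by omega) fun j hj =>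
    stiffness_one_sub_apply_eq_zero σ (by simp only; omega)]
  simp [Fin.sum_univ_three, stiffness_one_sub_apply, AtDist, IsEnd]

lemma stiffness_one_sub_mulVec_one (hN : 4 ≤ N) (σ : ℝ) (u : Fin N → ℝ) :
    (stiffness N 1 (1 - σ) σ *ᵥ u) ⟨1, by omega⟩ =
      (1 / 4 - 17 * σ / 16) * u ⟨0, by omega⟩ + (23 * σ / 16 + 1 / 2) * u ⟨1, by omega⟩ +
        -σ * u ⟨2, by omega⟩ + (σ - 1) / 4 * u ⟨3, by omega⟩ := by
  classical
  rw [mulVec_apply_eq_sum_window (k := 0) (m := 4) (by omega) fun j hj =>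
    stiffness_one_sub_apply_eq_zero σ (by simp only; omega)]
  have h₂ : 2 ≠ N := by omega
  have h₃ : 3 ≠ N := by omega
  simp [Fin.sum_univ_four, stiffness_one_sub_apply, AtDist, IsEnd, IsNextToEnd, h₂, h₃]

lemma stiffness_one_sub_mulVec_add_two {k : ℕ} (hk : k + 4 < N) (σ : ℝ) (u : Fin N → ℝ) :
    (stiffness N 1 (1 - σ) σ *ᵥ u) ⟨k + 2, by omega⟩ =
      (σ - 1) / 4 * u ⟨k, by omega⟩ + -σ * u ⟨k + 1, by omega⟩ +
        (3 * σ / 2 + 1 / 2) * u ⟨k + 2, by omega⟩ + -σ * u ⟨k + 3, by omega⟩ +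
        (σ - 1) / 4 * u ⟨k + 4, by omega⟩ := by
  classical
  rw [mulVec_apply_eq_sum_window (k := k) (m := 5) (by omega) fun j hj =>
    stiffness_one_sub_apply_eq_zero σ (by simp only; omega)]
  have h₀ : k + 2 + 1 ≠ k := by omega
  have h₂ : k + 1 + 1 ≠ N := by omega
  have h₃ : k + 2 + 1 ≠ N := by omega
  have h₄ : k + 2 + 2 ≠ N := by omega
  simp [Fin.sum_univ_five, stiffness_one_sub_apply, AtDist, IsEnd, IsNextToEnd, h₀, h₂, h₃, h₄]

lemma stiffness_one_sub_mulVec_cellParabola_pos_of_add_two_lt {σ : ℝ} (hσ : 0 ≤ σ) (hN : 4 ≤ N)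
    {i : Fin N} (hi : (i : ℕ) + 2 < N) :
    0 < (stiffness N 1 (1 - σ) σ *ᵥ cellParabola N) i := by
  obtain ⟨_ | _ | k, hk⟩ := i
  · have hrow : (stiffness N 1 (1 - σ) σ *ᵥ cellParabola N) ⟨0, hk⟩ = 11 * σ / 32 + 7 / 8 := by
      rw [stiffness_one_sub_mulVec_zero hN]
      simp only [cellParabola]
      push_cast
      ring
    rw [hrow]
    positivity
  · have hrow : (stiffness N 1 (1 - σ) σ *ᵥ cellParabola N) ⟨1, hk⟩ = 7 * σ / 32 + 15 / 8 := by
      rw [stiffness_one_sub_mulVec_one hN]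
      simp only [cellParabola]
      push_cast
      ring
    rw [hrow]
    positivity
  · have hrow : (stiffness N 1 (1 - σ) σ *ᵥ cellParabola N) ⟨k + 2, hk⟩ = 2 := by
      rw [stiffness_one_sub_mulVec_add_two hi]
      simp only [cellParabola]
      push_cast
      ring
    rw [hrow]
    exact two_pos

lemma stiffness_one_sub_mulVec_cellParabola_pos {σ : ℝ} (hσ : 0 ≤ σ) (hN : 4 ≤ N) (i : Fin N) :
    0 < (stiffness N 1 (1 - σ) σ *ᵥ cellParabola N) i := by
  by_cases hi : (i : ℕ) + 2 < N
  · exact stiffness_one_sub_mulVec_cellParabola_pos_of_add_two_lt hσ hN hi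
  · rw [← stiffness_mulVec_cellParabola_rev]
    refine stiffness_one_sub_mulVec_cellParabola_pos_of_add_two_lt hσ hN ?_
    rw [Fin.val_rev]
    omega

lemma isMonotone_stiffness_one_sub {h σ : ℝ} (hN : 4 ≤ N) (hh : 0 < h) (hσ₁ : 1 < σ)
    (hσ : σ ≤ 104 * Real.sqrt 2 / 79 - 12 / 79) : IsMonotone (stiffness N h (1 - σ) σ) := by
  rw [stiffness_eq_smul]
  exact ((isMonotone_toeplitzMax_one_sub hσ₁ hσ).of_le
    (stiffness_apply_le_toeplitzMax_apply (1 - σ) σ) cellParabola_nonneg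
    (stiffness_one_sub_mulVec_cellParabola_pos (by linarith) hN)).smul (one_div_pos.2 hh)

lemma not_isMMatrix_stiffness_of_coeffC0_pos {h ε σ : ℝ} (hN : 3 ≤ N) (hh : 0 < h)
    (hc : 0 < coeffC0 ε σ) : ¬ IsMMatrix (stiffness N h ε σ) := by
  intro hM
  have hentry : stiffness N h ε σ ⟨0, by omega⟩ ⟨2, by omega⟩ = 1 / h * coeffC0 ε σ := by
    simp [stiffness, AtDist, IsEnd]
  have hle := hM.apply_nonpos (i := ⟨0, by omega⟩) (j := ⟨2, by omega⟩) (by simp)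
  rw [hentry] at hle
  exact hle.not_gt (mul_pos (one_div_pos.2 hh) hc)

end Stiffness

end CCG

theorem mainTheorem1 (N : ℕ) (hN : 4 ≤ N) (h : ℝ) (hh : 0 < h) (ε σ : ℝ)
    (hsum : σ + ε = 1) (hσ : 1 < σ)
    (hσ' : σ ≤ 104 * Real.sqrt 2 / 79 - 12 / 79) :
    CCG.IsMonotone (CCG.toeplitzMax N ε σ) ∧
      CCG.IsMonotone (CCG.stiffness N h ε σ) ∧
      ¬ CCG.IsMMatrix (CCG.stiffness N h ε σ) := by
  obtain rfl : ε = 1 - σ := by linarith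
  have hc₀ : 0 < CCG.coeffC0 (1 - σ) σ := by
    rw [CCG.coeffC0]
    linarith
  exact ⟨CCG.isMonotone_toeplitzMax_one_sub hσ hσ',
    CCG.isMonotone_stiffness_one_sub hN hh hσ hσ',
    CCG.not_isMMatrix_stiffness_of_coeffC0_pos (by omega) hh hc₀⟩
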